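/- Let $N=\{1,2,3,\dots\}$ and let $\beta N$ be the set of ultrafilters on $N$, with the semigroup operation $A\in p\cdot q\iff\{n\in N:\{m\in N: nm\in A\}\in q\}\in p$; identify $n\in N$ with the principal ultrafilter at $n$, and for $A\subseteq N$ put $\overline A=\{p\in\beta N:A\in p\}$. For $p,q\in\beta N$ define - $p\mid_L q$ if $q=rp$ for some $r\in\beta N$; - $p\mid_R q$ if $q=pr$ for some $r\in\beta N$; - $p\mid_M q$ if $q=rps$ for some $r,s\in\beta N$; - $p\mid_{LN}q$ if $p\mid_L nq$ for some $n\in N$; - $p\mathrel{\widetilde\mid}q$ if for every $A\in p$ the set $\{m\in N:\exists a\in A,\ a\mid m\}$ belongs to $q$. Each of these relations $\rho$ is a preorder. Let $[p]_\rho=\{q:p\,\rho\,q\text{ and }q\,\rho\,p\}$, and order the set of classes by the partial order induced by $\rho$ (also written $\rho$); "maximal" and "greatest" refer to this order. Left, right and two-sided ideals of $\beta N$ are nonempty by definition, and $K(\beta N)$ is the smallest two-sided ideal of $\beta N$. Let $\mathcal U$ be the family of all nonempty $S\subseteq N$ such that $a\in S$ and $a\mid m$ imply $m\in S$. Then: (a)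 There are exactly $2^{\mathfrak c}$ maximal classes of $\mid_L$; they are exactly the minimal left ideals of $\beta N$; and for every $q\in\beta N$ there is $p\in\beta N$ such that $q\mid_L p$ and $[p]_L$ is maximal. (b) There are exactly $2^{\mathfrak c}$ maximal classes of $\mid_R$; they are exactly the minimal right ideals of $\beta N$; and for every $q\in\beta N$ there is $p\in\beta N$ such that $q\mid_R p$ and $[p]_R$ is maximal. (c) For every $q\in\beta N$ there is $p\in\beta N$ such that $q\mid_{LN}p$ and $[p]_{LN}$ is maximal. (d) There is a greatest class of $\mid_M$, and it is exactly $K(\beta N)$. (e) There is a greatest class of $\widetilde\mid$; it is exactly $\bigcap_{A\in\mathcal U}\overline A$, and it contains $K(\beta N)$. -/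

import Mathlib

namespace BetaDiv

/-- The Stone-Čech compactification `βN` of the discrete space `N = {1, 2, 3, …}`,
as the space of ultrafilters on `N`. -/
abbrev BetaN : Type := Ultrafilter ℕ+

/-- The extension of multiplication to `βN` (Mathlib's): `A ∈ p * q` iff
`{n | {m | n * m ∈ A} ∈ q} ∈ p`, see `mem_mul_iff`. -/
instance instSemigroupBetaN : Semigroup BetaN := Ultrafilter.semigroup

theorem mem_mul_iff (p q : BetaN) (A : Set ℕ+) :
    A ∈ p * q ↔ {n : ℕ+ | {m : ℕ+ | n * m ∈ A} ∈ q} ∈ p := Iff.rfl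

/-! ### The divisibility relations -/

/-- `p ∣_L q`: there is `r` with `q = r p`. -/
def DvdL (p q : BetaN) : Prop := ∃ r : BetaN, q = r * p

/-- `p ∣_R q`: there is `r` with `q = p r`. -/
def DvdR (p q : BetaN) : Prop := ∃ r : BetaN, q = p * r

/-- `p ∣_M q`: there are `r, s` with `q = r p s`. -/
def DvdM (p q : BetaN) : Prop := ∃ r s : BetaN, q = r * p * s

/-- `∣[A]`, the set of all multiples of elements of `A`. -/
def multiples (A : Set ℕ+) : Set ℕ+ := {m | ∃ a ∈ A, a ∣ m}

/-- `p ∣~ q`: for all `A ∈ p`, the set `∣[A]` belongs to `q`. -/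
def DvdTilde (p q : BetaN) : Prop := ∀ A ∈ p, multiples A ∈ q

/-- `p ∣_LN q`: there is `n ∈ N` with `p ∣_L n q`; `n ∈ N` is identified with the principal
ultrafilter `pure n`. -/
def DvdLN (p q : BetaN) : Prop := ∃ n : ℕ+, DvdL p ((pure n : BetaN) * q)

/-! ### The factor set of a preorder -/

/-- The class `[p]_ρ` of `p` under `p =_ρ q ↔ p ρ q ∧ q ρ p`. -/
def cls (ρ : BetaN → BetaN → Prop) (p : BetaN) : Set BetaN := {q | ρ p q ∧ ρ q p}

/-- The factor set of `βN` by `=_ρ`. -/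
def classes (ρ : BetaN → BetaN → Prop) : Set (Set BetaN) := Set.range (cls ρ)

/-- The order induced by a preorder `ρ` on its classes. -/
def ClassLE (ρ : BetaN → BetaN → Prop) (C D : Set BetaN) : Prop := ∃ p ∈ C, ∃ q ∈ D, ρ p q

/-- `C` is a maximal element of the factor set. -/
def IsMaximalClass (ρ : BetaN → BetaN → Prop) (C : Set BetaN) : Prop :=
  C ∈ classes ρ ∧ ∀ D ∈ classes ρ, ClassLE ρ C D → D = C

/-- `C` is the greatest element of the factor set. -/
def IsGreatestClass (ρ : BetaN → BetaN → Prop) (C : Set BetaN) : Prop :=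
  C ∈ classes ρ ∧ ∀ D ∈ classes ρ, ClassLE ρ D C

/-! ### Ideals of the semigroup `βN` -/

/-- A left ideal: nonempty, with `βN L ⊆ L`. -/
def IsLeftIdeal (L : Set BetaN) : Prop := L.Nonempty ∧ ∀ x : BetaN, ∀ y ∈ L, x * y ∈ L

/-- A right ideal: nonempty, with `R βN ⊆ R`. -/
def IsRightIdeal (R : Set BetaN) : Prop := R.Nonempty ∧ ∀ x : BetaN, ∀ y ∈ R, y * x ∈ R

/-- A minimal left ideal (minimal under inclusion among the left ideals). -/
def IsMinimalLeftIdeal (L : Set BetaN) : Prop := Minimal IsLeftIdeal L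

/-- A minimal right ideal (minimal under inclusion among the right ideals). -/
def IsMinimalRightIdeal (R : Set BetaN) : Prop := Minimal IsRightIdeal R

/-- The smallest (two-sided) ideal `K(βN)`, as the intersection of all two-sided ideals
(which is itself an ideal as soon as it is nonempty). -/
def K : Set BetaN := ⋂₀ {I | IsLeftIdeal I ∧ IsRightIdeal I}

/-! ### Upward closed sets -/

/-- `𝒰`: the nonempty subsets of `N` that are upward closed for divisibility. -/
def upwardClosed : Set (Set ℕ+) := {S | S.Nonempty ∧ ∀ a ∈ S, ∀ m : ℕ+, a ∣ m → m ∈ S}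

/-- The closure of `A ⊆ N` in `βN`: the ultrafilters to which `A` belongs. -/
def bar (A : Set ℕ+) : Set BetaN := {p | A ∈ p}

end BetaDiv

/-!
A nonempty compact right topological semigroup contains a *minimal idempotent* `e`: every `s * e`
can be multiplied back to `e` on the left, and every `e * s` on the right
(`exists_minimal_idempotent`). This one element produces all the existence claims for `βN`:
`e * q` lies above `q` for `∣_L` and for `∣_LN` and is maximal there, `q * e` lies above `q` for
`∣_R` and is maximal there, and `e` itself belongs to the greatest class of `∣_M` and of `∣~`. That
maximal classes are minimal ideals is order theory: the left (right) ideals are exactly the nonempty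
sets that are upward closed for `∣_L` (`∣_R`), and in any preorder the minimal nonempty upward
closed sets are the maximal classes (`isMaximalClass_iff_minimal`).

The number of maximal classes is at most `|βN| = 2 ^ 𝔠` (`mk_ultrafilter`, from an independent
family of `𝔠` subsets of a countable set). For the lower bound, let `p` range over the `2 ^ 𝔠`
nonprincipal ultrafilters on the set of primes. The left ideals `βN * p` are pairwise disjoint:
for a fixed `n`, `p`-almost all primes `ℓ` exceed all prime factors of `n`, so
`x * p` is mapped to `p` by "largest prime factor", for every `x` (`map_maxPrime_mul`).
The right ideals `p * βN` are pairwise disjoint as well: an ultrafilter `y` assigns to each prime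
`ℓ` a limit parity of the exponent of `ℓ`, and `p * r` has the same limit parities as `r`, because
`p`-almost all primes differ from `ℓ`. For a prime `ℓ` and `r`-almost all `m`, the least prime at
which the parity of the exponent of `ℓ * m` is not the limit parity is `ℓ`. Hence `p * r` is
mapped to `p` by a function that depends on the ultrafilter `p * r` only (`map_leastDefect_mul`).
-/

namespace BetaDiv

open Filter Cardinal

/-! ### Minimal idempotents of compact right topological semigroups -/

/-- The witness `e` is an idempotent in a minimal closed left ideal `L`. For `y ∈ L` the left ideal
`M * y` is closed, hence equal to `L`. This gives left inverses relative to `e`, and inside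
`e * M * e` left inverses are two-sided. -/
theorem exists_minimal_idempotent {M : Type*} [Semigroup M] [TopologicalSpace M] [CompactSpace M]
    [T2Space M] [Nonempty M] (hc : ∀ r : M, Continuous (· * r)) :
    ∃ e : M, (∀ s, ∃ z, z * (s * e) = e) ∧ ∀ s, ∃ z, e * s * z = e := by
  let S : Set (Set M) := {N | IsClosed N ∧ N.Nonempty ∧ ∀ x, ∀ y ∈ N, x * y ∈ N}
  obtain ⟨L, hL⟩ : ∃ L, Minimal (· ∈ S) L := by
    refine zorn_superset _ fun c hcs hch => ?_
    refine ⟨⋂₀ c, ⟨isClosed_sInter fun t ht => (hcs ht).1, ?_, fun x y hy => ?_⟩, fun s hs =>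
      Set.sInter_subset_of_mem hs⟩
    · obtain rfl | hne := c.eq_empty_or_nonempty
      · rw [Set.sInter_empty]
        exact Set.univ_nonempty
      · have := hne.to_subtype
        rw [Set.sInter_eq_iInter]
        exact IsCompact.nonempty_iInter_of_directed_nonempty_isCompact_isClosed _
          (DirectedOn.directed_val (IsChain.directedOn hch.symm)) (fun i => (hcs i.prop).2.1)
          (fun i => (hcs i.prop).1.isCompact) (fun i => (hcs i.prop).1)
    · rw [Set.mem_sInter] at hy ⊢
      exact fun t ht => (hcs ht).2.2 x y (hy t ht)
  obtain ⟨hcl, hne, hmul⟩ := hL.prop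
  obtain ⟨e, heL, hee⟩ := exists_idempotent_in_compact_subsemigroup hc L hne hcl.isCompact
    fun x _ y hy => hmul x y hy
  have key : ∀ y ∈ L, ∀ w ∈ L, ∃ z, z * y = w := by
    intro y hy w hw
    have : Set.range (· * y) = L := by
      apply hL.eq_of_subset
      · refine ⟨(isCompact_range (hc y)).isClosed, ⟨_, y, rfl⟩, ?_⟩
        rintro x _ ⟨z, rfl⟩
        exact ⟨x * z, mul_assoc _ _ _⟩
      · rintro _ ⟨z, rfl⟩
        exact hmul z y hy
    rw [← this] at hw
    exact hw
  refine ⟨e, fun s => key _ (hmul s e heL) e heL, fun s => ?_⟩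
  -- `w = e * s * e` has a left inverse `t` in `e * M * e`, which has a left inverse `t'` in turn;
  -- so `t` is also a right inverse of `w`.
  obtain ⟨t₀, ht₀⟩ := key (e * s * e) (hmul _ _ heL) e heL
  set w := e * s * e with hw
  have hew : e * w = w := by rw [hw, ← mul_assoc, ← mul_assoc, hee]
  set t := e * t₀ * e with ht
  have htw : t * w = e := by rw [ht, mul_assoc, hew, mul_assoc, ht₀, hee]
  have het : e * t = t := by rw [ht, ← mul_assoc, ← mul_assoc, hee]
  obtain ⟨t', ht'⟩ := key t (hmul _ _ heL) e heL
  have hwt : w * t = e :=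
    calc w * t = e * (w * t) := by rw [← mul_assoc e, hew]
      _ = t' * t * (w * t) := by rw [ht']
      _ = t' * (t * w * t) := by simp only [mul_assoc]
      _ = e := by rw [htw, het, ht']
  exact ⟨e * t, by rw [← mul_assoc, ← hw, hwt]⟩

theorem exists_minimal_idempotent_betaN :
    ∃ e : BetaN, (∀ s, ∃ z, z * (s * e) = e) ∧ ∀ s, ∃ z, e * s * z = e :=
  exists_minimal_idempotent (M := BetaN) fun r => Ultrafilter.continuous_mul_left r

/-! ### Principal ultrafilters in the semigroup -/

theorem mem_pure_mul_iff (n : ℕ+) (p : BetaN) (A : Set ℕ+) :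
    A ∈ (pure n : BetaN) * p ↔ {m | n * m ∈ A} ∈ p := by
  rw [mem_mul_iff, Ultrafilter.mem_pure]
  rfl

theorem mem_mul_pure_iff (n : ℕ+) (p : BetaN) (A : Set ℕ+) :
    A ∈ p * (pure n : BetaN) ↔ {m | m * n ∈ A} ∈ p := by
  rw [mem_mul_iff]
  rfl

theorem pure_one_mul (p : BetaN) : (pure 1 : BetaN) * p = p :=
  Ultrafilter.ext fun A => by simp [mem_pure_mul_iff]

theorem mul_pure_one (p : BetaN) : p * (pure 1 : BetaN) = p :=
  Ultrafilter.ext fun A => by simp [mem_mul_pure_iff]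

theorem pure_mul_comm (n : ℕ+) (p : BetaN) : (pure n : BetaN) * p = p * pure n :=
  Ultrafilter.ext fun A => by simp [mem_pure_mul_iff, mem_mul_pure_iff, mul_comm]

theorem pure_mul_pure (n m : ℕ+) : (pure n : BetaN) * pure m = pure (n * m) :=
  Ultrafilter.ext fun A => by rw [mem_pure_mul_iff, Ultrafilter.mem_pure, Ultrafilter.mem_pure]; rfl

/-! ### The divisibility preorders -/

theorem DvdL.refl (p : BetaN) : DvdL p p := ⟨pure 1, (pure_one_mul p).symm⟩

theorem DvdL.trans {p q r : BetaN} : DvdL p q → DvdL q r → DvdL p r := by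
  rintro ⟨x, rfl⟩ ⟨y, rfl⟩
  exact ⟨y * x, (mul_assoc _ _ _).symm⟩

theorem DvdR.refl (p : BetaN) : DvdR p p := ⟨pure 1, (mul_pure_one p).symm⟩

theorem DvdR.trans {p q r : BetaN} : DvdR p q → DvdR q r → DvdR p r := by
  rintro ⟨x, rfl⟩ ⟨y, rfl⟩
  exact ⟨x * y, mul_assoc _ _ _⟩

theorem DvdL.dvdLN {p q : BetaN} (h : DvdL p q) : DvdLN p q := ⟨1, by rwa [pure_one_mul]⟩

theorem DvdLN.trans {p q r : BetaN} : DvdLN p q → DvdLN q r → DvdLN p r := by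
  rintro ⟨n, x, hx⟩ ⟨m, y, hy⟩
  refine ⟨n * m, y * x, ?_⟩
  rw [← pure_mul_pure, mul_assoc, hy, mul_assoc, ← hx, ← mul_assoc, pure_mul_comm, mul_assoc]

/-! ### Maximal classes of a preorder -/

theorem isMaximalClass_iff {ρ : BetaN → BetaN → Prop} (hr : ∀ p, ρ p p)
    (ht : ∀ {p q r}, ρ p q → ρ q r → ρ p r) (C : Set BetaN) :
    IsMaximalClass ρ C ↔ ∃ p, C = {q | ρ p q} ∧ ∀ q, ρ p q → ρ q p := by
  constructor
  · rintro ⟨⟨p, rfl⟩, h⟩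
    have hp : ∀ q, ρ p q → ρ q p := fun q hq => by
      have := h (cls ρ q) ⟨q, rfl⟩ ⟨p, ⟨hr p, hr p⟩, q, ⟨hr q, hr q⟩, hq⟩
      have hq' : q ∈ cls ρ p := this ▸ ⟨hr q, hr q⟩
      exact hq'.2
    exact ⟨p, Set.ext fun q => ⟨fun hq => hq.1, fun hq => ⟨hq, hp q hq⟩⟩, hp⟩
  · rintro ⟨p, rfl, hp⟩
    refine ⟨⟨p, Set.ext fun q => ⟨fun hq => hq.1, fun hq => ⟨hq, hp q hq⟩⟩⟩, ?_⟩
    rintro _ ⟨d, rfl⟩ ⟨a, ha, b, hb, hab⟩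
    have hpd : ρ p d := ht (ht ha hab) hb.2
    ext q
    exact ⟨fun hq => ht hpd hq.1, fun hq => ⟨ht (hp d hpd) hq, ht (hp q hq) hpd⟩⟩

theorem isMaximalClass_cls {ρ : BetaN → BetaN → Prop} (hr : ∀ p, ρ p p)
    (ht : ∀ {p q r}, ρ p q → ρ q r → ρ p r) {p : BetaN} (hp : ∀ q, ρ p q → ρ q p) :
    IsMaximalClass ρ (cls ρ p) :=
  (isMaximalClass_iff hr ht _).2
    ⟨p, Set.ext fun q => ⟨fun hq => hq.1, fun hq => ⟨hq, hp q hq⟩⟩, hp⟩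

theorem isMaximalClass_iff_minimal {ρ : BetaN → BetaN → Prop} (hr : ∀ p, ρ p p)
    (ht : ∀ {p q r}, ρ p q → ρ q r → ρ p r) (C : Set BetaN) :
    IsMaximalClass ρ C ↔
      Minimal (fun I : Set BetaN => I.Nonempty ∧ ∀ p ∈ I, ∀ q, ρ p q → q ∈ I) C := by
  rw [isMaximalClass_iff hr ht]
  constructor
  · rintro ⟨p, rfl, hp⟩
    refine ⟨⟨⟨p, hr p⟩, fun a ha b hab => ht ha hab⟩, ?_⟩
    rintro I ⟨⟨i, hi⟩, hI⟩ hsub q hq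
    exact hI i hi q (ht (hp i (hsub hi)) hq)
  · intro h
    have key : ∀ p ∈ C, {q | ρ p q} = C := fun p hp =>
      h.eq_of_subset ⟨⟨p, hr p⟩, fun a ha b hab => ht ha hab⟩ fun q hq => h.prop.2 p hp q hq
    obtain ⟨p, hp⟩ := h.prop.1
    refine ⟨p, (key p hp).symm, fun q hq => ?_⟩
    have : p ∈ {r | ρ q r} := by
      rw [key q (h.prop.2 p hp q hq)]
      exact hp
    exact this

theorem isMaximalClass_dvdL_iff (C : Set BetaN) :
    IsMaximalClass DvdL C ↔ IsMinimalLeftIdeal C := by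
  rw [isMaximalClass_iff_minimal DvdL.refl DvdL.trans, IsMinimalLeftIdeal]
  have : (fun I : Set BetaN => I.Nonempty ∧ ∀ p ∈ I, ∀ q, DvdL p q → q ∈ I) = IsLeftIdeal := by
    funext I
    refine propext (and_congr_right fun _ => ⟨fun h x y hy => h y hy _ ⟨x, rfl⟩, ?_⟩)
    rintro h p hp _ ⟨r, rfl⟩
    exact h r p hp
  rw [this]

theorem isMaximalClass_dvdR_iff (C : Set BetaN) :
    IsMaximalClass DvdR C ↔ IsMinimalRightIdeal C := by
  rw [isMaximalClass_iff_minimal DvdR.refl DvdR.trans, IsMinimalRightIdeal]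
  have : (fun I : Set BetaN => I.Nonempty ∧ ∀ p ∈ I, ∀ q, DvdR p q → q ∈ I) = IsRightIdeal := by
    funext I
    refine propext (and_congr_right fun _ => ⟨fun h x y hy => h y hy _ ⟨x, rfl⟩, ?_⟩)
    rintro h p hp _ ⟨r, rfl⟩
    exact h r p hp
  rw [this]

/-! ### Existence of maximal elements above a given one -/

theorem exists_dvdL_maximal (q : BetaN) : ∃ p, DvdL q p ∧ ∀ r, DvdL p r → DvdL r p := by
  obtain ⟨e, he, -⟩ := exists_minimal_idempotent_betaN
  refine ⟨e * q, ⟨e, rfl⟩, ?_⟩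
  rintro _ ⟨s, rfl⟩
  obtain ⟨z, hz⟩ := he s
  exact ⟨z, by rw [← mul_assoc s, ← mul_assoc, hz]⟩

theorem exists_dvdR_maximal (q : BetaN) : ∃ p, DvdR q p ∧ ∀ r, DvdR p r → DvdR r p := by
  obtain ⟨e, -, he⟩ := exists_minimal_idempotent_betaN
  refine ⟨q * e, ⟨e, rfl⟩, ?_⟩
  rintro _ ⟨s, rfl⟩
  obtain ⟨z, hz⟩ := he s
  exact ⟨z, by rw [mul_assoc q, mul_assoc, hz]⟩

/-- An element of a minimal left ideal is maximal for the coarser preorder `∣_LN` too: if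
`n * r = x * p`, then `p = z * (n * r)` for some `z`. -/
theorem DvdL.dvdLN_maximal {p : BetaN} (hp : ∀ r, DvdL p r → DvdL r p) (r : BetaN)
    (h : DvdLN p r) : DvdLN r p := by
  obtain ⟨n, hn⟩ := h
  exact (DvdL.trans ⟨pure n, rfl⟩ (hp _ hn)).dvdLN

/-! ### The number of ultrafilters on a countable set -/

/-- The member with index `X` of an independent family of `𝔠` subsets of a countable set: the pairs
`(F, 𝓕)` of a finite set `F` of numbers and a finite family `𝓕` of finite sets with
`F ∩ X ∈ 𝓕`. -/
def indepSet (X : Set ℕ) : Set (Finset ℕ × Finset (Finset ℕ)) :=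
  {j | ∃ F ∈ j.2, ∀ n, n ∈ F ↔ n ∈ j.1 ∧ n ∈ X}

/-- Independence: a finite subset of `ℕ` that is large enough has distinct traces on
finitely many distinct sets, so its second component can be chosen to be the set of the traces of
the members of `T`. -/
theorem exists_forall_mem_indepSet_iff (T : Set (Set ℕ)) (s : Finset (Set ℕ)) :
    ∃ j, ∀ X ∈ s, j ∈ indepSet X ↔ X ∈ T := by
  classical
  have h : ∀ᶠ F : Finset ℕ in atTop, ∀ X ∈ s, ∀ Y ∈ s,
      F.filter (· ∈ X) = F.filter (· ∈ Y) → X = Y := by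
    simp only [Filter.eventually_all_finset]
    intro X _ Y _
    by_cases hXY : X = Y
    · exact Eventually.of_forall fun _ _ => hXY
    · obtain ⟨n, hn⟩ : ∃ n, ¬(n ∈ X ↔ n ∈ Y) := by
        by_contra! hcon
        exact hXY (Set.ext hcon)
      filter_upwards [eventually_ge_atTop {n}] with F hF hEq
      have hnF : n ∈ F := hF (Finset.mem_singleton_self n)
      have := Finset.ext_iff.1 hEq n
      simp only [Finset.mem_filter, hnF, true_and] at this
      exact absurd this hn
  obtain ⟨F, hF⟩ := h.exists
  refine ⟨(F, (s.filter (· ∈ T)).image fun X => F.filter (· ∈ X)), fun X hX => ⟨?_, fun hT => ?_⟩⟩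
  · rintro ⟨G, hG, hGX⟩
    obtain ⟨Y, hY, rfl⟩ := Finset.mem_image.1 hG
    obtain ⟨hYs, hYT⟩ := Finset.mem_filter.1 hY
    have : Y = X := hF Y hYs X hX (Finset.ext fun n => by simpa using hGX n)
    exact this ▸ hYT
  · exact ⟨F.filter (· ∈ X), Finset.mem_image.2 ⟨X, Finset.mem_filter.2 ⟨hX, hT⟩, rfl⟩,
      fun n => Finset.mem_filter⟩

theorem exists_ultrafilter_indepSet_mem_iff (T : Set (Set ℕ)) :
    ∃ u : Ultrafilter (Finset ℕ × Finset (Finset ℕ)), {X | indepSet X ∈ u} = T := by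
  classical
  -- `B X` is the set of `j` at which membership in `indepSet X` is as prescribed by `T`.
  let B : Set ℕ → Set (Finset ℕ × Finset (Finset ℕ)) := fun X => {j | j ∈ indepSet X ↔ X ∈ T}
  obtain ⟨u, hu⟩ := Ultrafilter.exists_ultrafilter_of_finite_inter_nonempty (Set.range B) (by
    intro t ht
    rw [← Set.image_univ] at ht
    obtain ⟨s, -, rfl⟩ := Finset.subset_set_image_iff.1 ht
    obtain ⟨j, hj⟩ := exists_forall_mem_indepSet_iff T s
    refine ⟨j, Set.mem_sInter.2 fun b hb => ?_⟩
    obtain ⟨X, hX, rfl⟩ := Finset.mem_image.1 (Finset.mem_coe.1 hb)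
    exact hj X hX)
  refine ⟨u, Set.ext fun X => ?_⟩
  have hX : B X ∈ u := hu ⟨X, rfl⟩
  constructor
  · intro h
    obtain ⟨j, hj, hj'⟩ := Ultrafilter.nonempty_of_mem (Filter.inter_mem hX h)
    exact hj.1 hj'
  · intro h
    exact Filter.mem_of_superset hX fun j hj => hj.2 h

theorem ultrafilter_map_injective {α β : Type*} {f : α → β} (hf : Function.Injective f) :
    Function.Injective (Ultrafilter.map f) := fun _ _ h =>
  Ultrafilter.coe_injective (Filter.map_injective hf (congrArg Ultrafilter.toFilter h))

theorem mk_ultrafilter (α : Type) [Countable α] [Infinite α] : #(Ultrafilter α) = 2 ^ 𝔠 := by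
  apply le_antisymm
  · calc #(Ultrafilter α) ≤ #(Set (Set α)) := by
          refine mk_le_of_injective (f := fun u => {A | A ∈ u}) fun u v h => ?_
          exact Ultrafilter.ext fun A => Set.ext_iff.1 h A
      _ = 2 ^ 𝔠 := by rw [mk_set, mk_set, mk_eq_aleph0, two_power_aleph0]
  · obtain ⟨f⟩ : Nonempty ((Finset ℕ × Finset (Finset ℕ)) ≃ α) :=
      Cardinal.eq.1 (by rw [mk_eq_aleph0, mk_eq_aleph0])
    calc (2 : Cardinal) ^ 𝔠 = #(Set (Set ℕ)) := by
          rw [mk_set, mk_set, mk_eq_aleph0, two_power_aleph0]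
      _ ≤ #(Ultrafilter (Finset ℕ × Finset (Finset ℕ))) :=
          mk_le_of_surjective (f := fun u => {X | indepSet X ∈ u})
            exists_ultrafilter_indepSet_mem_iff
      _ ≤ #(Ultrafilter α) := mk_le_of_injective (ultrafilter_map_injective f.injective)

theorem mk_nonprincipal_ultrafilter (α : Type) [Countable α] [Infinite α] :
    #{u : Ultrafilter α // (u : Filter α) ≤ cofinite} = 2 ^ 𝔠 := by
  have hlt : ℵ₀ < (2 : Cardinal) ^ 𝔠 := aleph0_lt_continuum.trans (cantor 𝔠)
  have : Infinite (Ultrafilter α) := by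
    rw [Cardinal.infinite_iff, mk_ultrafilter]
    exact hlt.le
  rw [← mk_ultrafilter α, ← mk_compl_of_infinite (Set.range (pure : α → Ultrafilter α))]
  · refine mk_congr (Equiv.subtypeEquivRight fun u => ?_)
    constructor
    · rintro hu ⟨a, rfl⟩
      exact (hu (Set.finite_singleton a).compl_mem_cofinite : a ∈ ({a} : Set α)ᶜ) rfl
    · intro hu
      exact u.le_cofinite_or_eq_pure.resolve_right fun ⟨a, ha⟩ => hu ⟨a, ha.symm⟩
  · rw [mk_ultrafilter]
    exact mk_range_le.trans_lt (by rwa [mk_eq_aleph0])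

/-! ### Ultrafilters on the primes generate disjoint left ideals and disjoint right ideals -/

/-- The ultrafilter on `N` that extends an ultrafilter on the set of primes. -/
def ofPrimes (p : Ultrafilter Nat.Primes) : BetaN := p.map fun ℓ => (ℓ : ℕ+)

theorem eventually_ofPrimes_mul {p : Ultrafilter Nat.Primes} {r : BetaN} {P : ℕ+ → Prop} :
    (∀ᶠ m in (ofPrimes p * r : BetaN), P m) ↔
      ∀ᶠ ℓ : Nat.Primes in (p : Filter Nat.Primes),
        ∀ᶠ m : ℕ+ in (r : Filter ℕ+), P ((ℓ : ℕ+) * m) := Iff.rfl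

theorem eventually_mul_ofPrimes {p : Ultrafilter Nat.Primes} {r : BetaN} {P : ℕ+ → Prop} :
    (∀ᶠ m in (r * ofPrimes p : BetaN), P m) ↔
      ∀ᶠ n : ℕ+ in (r : Filter ℕ+),
        ∀ᶠ ℓ : Nat.Primes in (p : Filter Nat.Primes), P (n * (ℓ : ℕ+)) := Iff.rfl

theorem map_coe_primes_injective :
    Function.Injective (Ultrafilter.map fun ℓ : Nat.Primes => (ℓ : ℕ)) :=
  ultrafilter_map_injective Nat.Primes.coe_nat_injective

theorem eventually_lt_primes {p : Ultrafilter Nat.Primes} (hp : (p : Filter Nat.Primes) ≤ cofinite)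
    (k : ℕ) : ∀ᶠ ℓ : Nat.Primes in (p : Filter Nat.Primes), k < (ℓ : ℕ) := by
  have h : {ℓ : Nat.Primes | (ℓ : ℕ) ≤ k}.Finite :=
    (Set.finite_Iic k).preimage Nat.Primes.coe_nat_injective.injOn
  filter_upwards [hp h.compl_mem_cofinite] with ℓ hℓ
  exact not_le.1 hℓ

/-- The largest prime factor of `n`, which is `0` for `n = 1`. -/
def maxPrime (n : ℕ+) : ℕ := (n : ℕ).primeFactors.sup id

theorem map_maxPrime_mul (x : BetaN) {p : Ultrafilter Nat.Primes}
    (hp : (p : Filter Nat.Primes) ≤ cofinite) :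
    (x * ofPrimes p : BetaN).map maxPrime = p.map fun ℓ : Nat.Primes => (ℓ : ℕ) := by
  have h : ∀ᶠ n : ℕ+ in (x : Filter ℕ+),
      ∀ᶠ ℓ : Nat.Primes in (p : Filter Nat.Primes), maxPrime (n * (ℓ : ℕ+)) = ℓ := by
    refine Eventually.of_forall fun n => ?_
    filter_upwards [eventually_lt_primes hp (maxPrime n)] with ℓ hℓ
    have : maxPrime (n * (ℓ : ℕ+)) = maxPrime n ⊔ ℓ := by
      simp only [maxPrime, PNat.mul_coe, Nat.Primes.coe_pnat_nat]
      rw [Nat.primeFactors_mul n.ne_zero ℓ.2.ne_zero, Finset.sup_union, ℓ.2.primeFactors]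
      simp
    rw [this]
    exact sup_eq_right.2 hℓ.le
  refine (Ultrafilter.eq_of_le (Filter.le_def.2 fun A hA => ?_)).symm
  have hx : ∀ᶠ n : ℕ+ in (x : Filter ℕ+),
      ∀ᶠ ℓ : Nat.Primes in (p : Filter Nat.Primes), (ℓ : ℕ) ∈ A := by
    filter_upwards [h, eventually_mul_ofPrimes.1 (show ∀ᶠ m in (x * ofPrimes p : BetaN),
      maxPrime m ∈ A from hA)] with n h₁ h₂
    filter_upwards [h₁, h₂] with ℓ h₃ h₄
    rwa [h₃] at h₄
  obtain ⟨n, hn⟩ := hx.exists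
  exact hn

/-- The limit along `y` of the parity of the exponent of `j`: whether it is eventually even. -/
def LimEven (y : BetaN) (j : ℕ) : Prop :=
  ∀ᶠ m : ℕ+ in (y : Filter ℕ+), Even ((m : ℕ).factorization j)

/-- The least number at which the parity of the exponent in `m` differs from its limit along `y`.
It is prime if there is one, since the exponents of other numbers are `0`; otherwise it is `0`. -/
noncomputable def leastDefect (y : BetaN) (m : ℕ+) : ℕ :=
  sInf {j | ¬(Even ((m : ℕ).factorization j) ↔ LimEven y j)}

theorem eventually_even_iff_limEven (y : BetaN) (j : ℕ) :
    ∀ᶠ m : ℕ+ in (y : Filter ℕ+), (Even ((m : ℕ).factorization j) ↔ LimEven y j) := by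
  by_cases h : LimEven y j
  · filter_upwards [h] with m hm using iff_of_true hm h
  · filter_upwards [Ultrafilter.eventually_not.2 h] with m hm using iff_of_false hm h

theorem factorization_prime_mul (ℓ : Nat.Primes) (m : ℕ+) (j : ℕ) :
    (((ℓ : ℕ+) * m : ℕ+) : ℕ).factorization j =
      (if (ℓ : ℕ) = j then 1 else 0) + (m : ℕ).factorization j := by
  rw [PNat.mul_coe, Nat.Primes.coe_pnat_nat, Nat.factorization_mul ℓ.2.ne_zero m.ne_zero,
    ℓ.2.factorization, Finsupp.add_apply, Finsupp.single_apply]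

theorem limEven_ofPrimes_mul {p : Ultrafilter Nat.Primes}
    (hp : (p : Filter Nat.Primes) ≤ cofinite) (r : BetaN) :
    LimEven (ofPrimes p * r) = LimEven r := by
  funext j
  have h : ∀ᶠ ℓ : Nat.Primes in (p : Filter Nat.Primes), (∀ᶠ m : ℕ+ in (r : Filter ℕ+),
      Even ((((ℓ : ℕ+) * m : ℕ+) : ℕ).factorization j)) ↔ LimEven r j := by
    filter_upwards [eventually_lt_primes hp j] with ℓ hℓ
    simp only [factorization_prime_mul, if_neg hℓ.ne', zero_add, LimEven]
  rw [LimEven, eventually_ofPrimes_mul, eventually_congr h]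
  simp

theorem map_leastDefect_mul {p : Ultrafilter Nat.Primes}
    (hp : (p : Filter Nat.Primes) ≤ cofinite) (r : BetaN) :
    (ofPrimes p * r : BetaN).map (leastDefect (ofPrimes p * r)) =
      p.map fun ℓ : Nat.Primes => (ℓ : ℕ) := by
  have h : ∀ ℓ : Nat.Primes, ∀ᶠ m : ℕ+ in (r : Filter ℕ+),
      leastDefect (ofPrimes p * r) ((ℓ : ℕ+) * m) = ℓ := by
    intro ℓ
    have hr : ∀ᶠ m : ℕ+ in (r : Filter ℕ+), ∀ j ∈ Finset.range (ℓ + 1),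
        (Even ((m : ℕ).factorization j) ↔ LimEven r j) :=
      (eventually_all_finset _).2 fun j _ => eventually_even_iff_limEven r j
    filter_upwards [hr] with m hm
    refine IsLeast.csInf_eq ⟨?_, fun j hj => ?_⟩
    · rw [Set.mem_ofPred_eq, factorization_prime_mul, limEven_ofPrimes_mul hp, if_pos rfl,
        ← hm ℓ (Finset.self_mem_range_succ _), add_comm, Nat.even_add_one]
      tauto
    · by_contra! hlt
      refine hj ?_
      rw [factorization_prime_mul, limEven_ofPrimes_mul hp, if_neg hlt.ne', zero_add]
      exact hm j (Finset.mem_range.2 (by omega))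
  refine (Ultrafilter.eq_of_le (Filter.le_def.2 fun A hA => ?_)).symm
  have hA' := eventually_ofPrimes_mul.1 (show ∀ᶠ m in (ofPrimes p * r : BetaN),
    leastDefect (ofPrimes p * r) m ∈ A from hA)
  change ∀ᶠ ℓ : Nat.Primes in (p : Filter Nat.Primes), (ℓ : ℕ) ∈ A
  filter_upwards [hA'] with ℓ hℓ
  obtain ⟨m, hm, hm'⟩ := (hℓ.and (h ℓ)).exists
  rwa [hm'] at hm

/-! ### The number of maximal classes -/

/-- If distinct nonprincipal ultrafilters on the primes have no common upper bound for `ρ`, then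
maximal classes above them are distinct. -/
theorem mk_maximalClass {ρ : BetaN → BetaN → Prop} (hr : ∀ p, ρ p p)
    (ht : ∀ {p q r}, ρ p q → ρ q r → ρ p r) (hmax : ∀ q, ∃ p, ρ q p ∧ ∀ r, ρ p r → ρ r p)
    (hdisj : ∀ p q : Ultrafilter Nat.Primes, (p : Filter Nat.Primes) ≤ cofinite →
      (q : Filter Nat.Primes) ≤ cofinite → ∀ y, ρ (ofPrimes p) y → ρ (ofPrimes q) y → p = q) :
    #{C : Set BetaN // IsMaximalClass ρ C} = 2 ^ 𝔠 := by
  apply le_antisymm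
  · calc #{C : Set BetaN // IsMaximalClass ρ C} ≤ #(classes ρ) := mk_subtype_mono fun C hC => hC.1
      _ ≤ #BetaN := mk_range_le
      _ = 2 ^ 𝔠 := mk_ultrafilter ℕ+
  · choose f hf hfmax using hmax
    rw [← mk_nonprincipal_ultrafilter Nat.Primes]
    refine mk_le_of_injective (f := fun p =>
      ⟨cls ρ (f (ofPrimes p.1)), isMaximalClass_cls hr ht (hfmax _)⟩) fun p q h => ?_
    have h' : cls ρ (f (ofPrimes p.1)) = cls ρ (f (ofPrimes q.1)) := congrArg Subtype.val h
    have hmem : f (ofPrimes q.1) ∈ cls ρ (f (ofPrimes p.1)) := h' ▸ ⟨hr _, hr _⟩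
    exact Subtype.ext (hdisj _ _ p.2 q.2 _ (ht (hf _) hmem.1) (hf _))

theorem mk_maximalClass_dvdL : #{C : Set BetaN // IsMaximalClass DvdL C} = 2 ^ 𝔠 := by
  refine mk_maximalClass DvdL.refl DvdL.trans exists_dvdL_maximal ?_
  rintro p q hp hq y ⟨x, rfl⟩ ⟨x', hx'⟩
  apply map_coe_primes_injective
  rw [← map_maxPrime_mul x hp, ← map_maxPrime_mul x' hq, hx']

theorem mk_maximalClass_dvdR : #{C : Set BetaN // IsMaximalClass DvdR C} = 2 ^ 𝔠 := by
  refine mk_maximalClass DvdR.refl DvdR.trans exists_dvdR_maximal ?_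
  rintro p q hp hq y ⟨x, rfl⟩ ⟨x', hx'⟩
  apply map_coe_primes_injective
  rw [← map_leastDefect_mul hp x, ← map_leastDefect_mul hq x', hx']

/-! ### The smallest ideal and the greatest classes -/

theorem K_eq_setOf_dvdM {e : BetaN} (he : ∀ s, ∃ z, e * s * z = e) : K = {q | DvdM e q} := by
  apply Set.Subset.antisymm
  · refine Set.sInter_subset_of_mem ⟨⟨⟨_, e, e, rfl⟩, ?_⟩, ⟨_, e, e, rfl⟩, ?_⟩
    · rintro x _ ⟨r, s, rfl⟩
      exact ⟨x * r, s, by simp only [mul_assoc]⟩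
    · rintro x _ ⟨r, s, rfl⟩
      exact ⟨r, s * x, by simp only [mul_assoc]⟩
  · rintro _ ⟨r, s, rfl⟩ I ⟨⟨⟨x, hx⟩, hl⟩, -, hright⟩
    obtain ⟨z, hz⟩ := he x
    have heI : e ∈ I := hz ▸ hright z _ (hl e x hx)
    exact hright s _ (hl r e heI)

theorem isGreatestClass_dvdM : IsGreatestClass DvdM K := by
  obtain ⟨e, hl, hright⟩ := exists_minimal_idempotent_betaN
  rw [K_eq_setOf_dvdM hright]
  have he : ∀ p, DvdM p e := fun p => by
    obtain ⟨z, hz⟩ := hright p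
    exact ⟨e, z, hz.symm⟩
  refine ⟨⟨e, Set.ext fun q => ⟨fun hq => hq.1, fun hq => ⟨hq, he q⟩⟩⟩, ?_⟩
  rintro _ ⟨p, rfl⟩
  have hrefl : DvdM p p := ⟨pure 1, pure 1, by rw [pure_one_mul, mul_pure_one]⟩
  exact ⟨p, ⟨hrefl, hrefl⟩, e, he e, he p⟩

theorem subset_multiples (A : Set ℕ+) : A ⊆ multiples A := fun a ha => ⟨a, ha, dvd_rfl⟩

theorem multiples_mem_upwardClosed {A : Set ℕ+} (hA : A.Nonempty) :
    multiples A ∈ upwardClosed := by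
  refine ⟨hA.mono (subset_multiples A), ?_⟩
  rintro m ⟨a, ha, ham⟩ k hmk
  exact ⟨a, ha, ham.trans hmk⟩

theorem K_subset_iInter_bar : K ⊆ ⋂ A ∈ upwardClosed, bar A := by
  refine Set.subset_iInter₂ fun A hA => Set.sInter_subset_of_mem ?_
  obtain ⟨⟨a, ha⟩, hup⟩ := hA
  have hne : (bar A).Nonempty := ⟨pure a, Ultrafilter.mem_pure.2 ha⟩
  refine ⟨⟨hne, fun x y hy => ?_⟩, hne, fun x y hy => ?_⟩
  · exact (mem_mul_iff _ _ _).2 (Filter.univ_mem' fun n =>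
      Filter.mem_of_superset hy fun m hm => hup m hm _ (dvd_mul_left m n))
  · exact (mem_mul_iff _ _ _).2 (Filter.mem_of_superset hy fun n hn =>
      Filter.univ_mem' fun m => hup n hn _ (dvd_mul_right n m))

theorem dvdTilde_of_mem_iInter_bar (p : BetaN) {q : BetaN}
    (hq : q ∈ ⋂ A ∈ upwardClosed, bar A) : DvdTilde p q := fun _ hA =>
  Set.mem_iInter₂.1 hq _ (multiples_mem_upwardClosed (Ultrafilter.nonempty_of_mem hA))

theorem isGreatestClass_dvdTilde :
    IsGreatestClass DvdTilde (⋂ A ∈ upwardClosed, bar A) := by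
  obtain ⟨e, -, he⟩ := exists_minimal_idempotent_betaN
  have heG : e ∈ ⋂ A ∈ upwardClosed, bar A := by
    refine K_subset_iInter_bar ?_
    rw [K_eq_setOf_dvdM he]
    exact ⟨pure 1, pure 1, by rw [pure_one_mul, mul_pure_one]⟩
  refine ⟨⟨e, Set.ext fun q => ⟨fun hq => Set.mem_iInter₂.2 fun A hA => ?_, fun hq =>
    ⟨dvdTilde_of_mem_iInter_bar e hq, dvdTilde_of_mem_iInter_bar q heG⟩⟩⟩, ?_⟩
  · refine Filter.mem_of_superset (hq.1 A (Set.mem_iInter₂.1 heG A hA)) ?_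
    rintro m ⟨a, ha, ham⟩
    exact hA.2 a ha m ham
  · rintro _ ⟨p, rfl⟩
    have hrefl : DvdTilde p p := fun A hA => Filter.mem_of_superset hA (subset_multiples A)
    exact ⟨p, ⟨hrefl, hrefl⟩, e, heG, dvdTilde_of_mem_iInter_bar p heG⟩

end BetaDiv

theorem mainTheorem1 :
    -- (a) left divisibility
    (Cardinal.mk {C : Set BetaDiv.BetaN // BetaDiv.IsMaximalClass BetaDiv.DvdL C}
        = 2 ^ Cardinal.continuum ∧
      (∀ C : Set BetaDiv.BetaN,
        BetaDiv.IsMaximalClass BetaDiv.DvdL C ↔ BetaDiv.IsMinimalLeftIdeal C) ∧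
      (∀ q : BetaDiv.BetaN, ∃ p : BetaDiv.BetaN, BetaDiv.DvdL q p ∧
        BetaDiv.IsMaximalClass BetaDiv.DvdL (BetaDiv.cls BetaDiv.DvdL p))) ∧
    -- (b) right divisibility
    (Cardinal.mk {C : Set BetaDiv.BetaN // BetaDiv.IsMaximalClass BetaDiv.DvdR C}
        = 2 ^ Cardinal.continuum ∧
      (∀ C : Set BetaDiv.BetaN,
        BetaDiv.IsMaximalClass BetaDiv.DvdR C ↔ BetaDiv.IsMinimalRightIdeal C) ∧
      (∀ q : BetaDiv.BetaN, ∃ p : BetaDiv.BetaN, BetaDiv.DvdR q p ∧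
        BetaDiv.IsMaximalClass BetaDiv.DvdR (BetaDiv.cls BetaDiv.DvdR p))) ∧
    -- (c) left divisibility up to elements of N
    (∀ q : BetaDiv.BetaN, ∃ p : BetaDiv.BetaN, BetaDiv.DvdLN q p ∧
      BetaDiv.IsMaximalClass BetaDiv.DvdLN (BetaDiv.cls BetaDiv.DvdLN p)) ∧
    -- (d) mid-divisibility
    BetaDiv.IsGreatestClass BetaDiv.DvdM BetaDiv.K ∧
    -- (e) the divisibility through multiples of sets
    (BetaDiv.IsGreatestClass BetaDiv.DvdTilde (⋂ A ∈ BetaDiv.upwardClosed, BetaDiv.bar A) ∧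
      BetaDiv.K ⊆ ⋂ A ∈ BetaDiv.upwardClosed, BetaDiv.bar A) := by
  refine ⟨⟨BetaDiv.mk_maximalClass_dvdL, BetaDiv.isMaximalClass_dvdL_iff, fun q => ?_⟩,
    ⟨BetaDiv.mk_maximalClass_dvdR, BetaDiv.isMaximalClass_dvdR_iff, fun q => ?_⟩, fun q => ?_,
    BetaDiv.isGreatestClass_dvdM, BetaDiv.isGreatestClass_dvdTilde, BetaDiv.K_subset_iInter_bar⟩
  · obtain ⟨p, hqp, hp⟩ := BetaDiv.exists_dvdL_maximal q
    exact ⟨p, hqp, BetaDiv.isMaximalClass_cls BetaDiv.DvdL.refl BetaDiv.DvdL.trans hp⟩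
  · obtain ⟨p, hqp, hp⟩ := BetaDiv.exists_dvdR_maximal q
    exact ⟨p, hqp, BetaDiv.isMaximalClass_cls BetaDiv.DvdR.refl BetaDiv.DvdR.trans hp⟩
  · obtain ⟨p, hqp, hp⟩ := BetaDiv.exists_dvdL_maximal q
    exact ⟨p, hqp.dvdLN, BetaDiv.isMaximalClass_cls (fun r => (BetaDiv.DvdL.refl r).dvdLN)
      BetaDiv.DvdLN.trans (BetaDiv.DvdL.dvdLN_maximal hp)⟩
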